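/- Let $(|1|,|2|)\in(\mathbb Z/2)^2$ with $|1|\neq|2|$, and let $Y=Y(\mathfrak{gl}_{1|1})$ be the associative superalgebra over $\mathbb C$ with generators $t_{i,j}^{(r)}$ ($1\le i,j\le 2$, $r>0$), with $t_{i,j}^{(r)}$ of parity $|i|+|j|$, subject to the relations $$[t_{i,j}^{(r)},t_{p,q}^{(s)}]=(-1)^{|i||j|+|i||p|+|j||p|}\sum_{a=0}^{\min(r,s)-1}\Bigl(t_{p,j}^{(a)}t_{i,q}^{(r+s-1-a)}-t_{p,j}^{(r+s-1-a)}t_{i,q}^{(a)}\Bigr),$$ where $[x,y]=xy-(-1)^{|x||y|}yx$ and $t_{i,j}^{(0)}=\delta_{i,j}$. Put $t_{i,j}(u)=\sum_{r\ge0}t_{i,j}^{(r)}u^{-r}\in Y[[u^{-1}]]$. Let $\Delta:Y\to Y\otimes Y$ be the comultiplication, i.e. the superalgebra homomorphism with $\Delta(t_{i,j}(u))=\sum_{h=1}^2t_{i,h}(u)\otimes t_{h,j}(u)$, where $Y\otimes Y$ has the product $(a\otimes b)(c\otimes d)=(-1)^{|b||c|}ac\otimes bd$ for homogeneous $b$ and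 $c$; for power series, $\Delta$ is applied coefficientwise and $a(u)\otimes b(u)=\sum_{r,s}a^{(r)}\otimes b^{(s)}u^{-r-s}$. Define $$d_1(u)=t_{1,1}(u),\quad d_2(u)=t_{2,2}(u)-t_{2,1}(u)t_{1,1}(u)^{-1}t_{1,2}(u),\quad e(u)=t_{1,1}(u)^{-1}t_{1,2}(u),\quad f(u)=t_{2,1}(u)t_{1,1}(u)^{-1},$$ and $\tilde d_i(u)=d_i(u)^{-1}$ for $i=1,2$. Then the following identities hold in $(Y\otimes Y)[[u^{-1}]]$, where in each infinite sum only finitely many terms contribute to the coefficient of any given power of $u^{-1}$: \begin{align*} \Delta(d_1(u)) &= d_1(u)\otimes d_1(u)+d_1(u)e(u)\otimes f(u)d_1(u),\\ \Delta(\tilde d_1(u)) &= \sum_{n\ge0}(-1)^{\lceil n/2\rceil}e(u)^n\tilde d_1(u)\otimes\tilde d_1(u)f(u)^n,\\ \Delta(d_2(u)) &= \sum_{n\ge0}(-1)^{\lfloor n/2\rfloor}d_2(u)e(u)^n\otimes f(u)^nd_2(u),\\ \Delta(\tilde d_2(u)) &= \tilde d_2(u)\otimes\tilde d_2(u)-e(u)\tilde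 d_2(u)\otimes\tilde d_2(u)f(u),\\ \Delta(e(u)) &= 1\otimes e(u)-\sum_{n\ge1}(-1)^{\lceil n/2\rceil}e(u)^n\otimes\tilde d_1(u)f(u)^{n-1}d_2(u),\\ \Delta(f(u)) &= f(u)\otimes1-\sum_{n\ge1}(-1)^{\lceil n/2\rceil}d_2(u)e(u)^{n-1}\tilde d_1(u)\otimes f(u)^n. \end{align*} -/

import Mathlib

open scoped TensorProduct

noncomputable section

namespace SuperYangian

/-- The sign `(-1)^a` for `a ∈ ℤ/2`. -/
def sgn (a : ZMod 2) : ℂ := if a = 0 then 1 else -1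

theorem sgn_zero : sgn 0 = 1 := if_pos rfl

theorem sgn_one : sgn 1 = -1 := if_neg (by decide)

theorem sgn_add (a b : ZMod 2) : sgn (a + b) = sgn a * sgn b := by
  have h : (1 + 1 : ZMod 2) = 0 := by decide
  have h2 : ∀ x : ZMod 2, x = 0 ∨ x = 1 := by decide
  rcases h2 a with rfl | rfl <;> rcases h2 b with rfl | rfl <;> simp [sgn_zero, sgn_one, h]

theorem sgn_mul_self (a : ZMod 2) : sgn a * sgn a = 1 := by
  have h2 : ∀ x : ZMod 2, x = 0 ∨ x = 1 := by decide
  rcases h2 a with rfl | rfl <;> simp [sgn_zero, sgn_one]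

/-- The generator symbols `t_{i,j}^{(r)}`, `r > 0`. The two indices `1, 2` of the rows and columns
are the elements `0, 1` of `Fin 2`. -/
structure Gen where
  row : Fin 2
  col : Fin 2
  deg : ℕ+

/-- The parity `|i| + |j|` of the generator `t_{i,j}^{(r)}`, where `p` is the parity sequence. -/
def Gen.parity (p : Fin 2 → ZMod 2) (g : Gen) : ZMod 2 := p g.row + p g.col

/-- `t_{i,j}^{(r)}` in the free algebra, with `t_{i,j}^{(0)} = δ_{i,j}`. -/
def freeT (i j : Fin 2) (r : ℕ) : FreeAlgebra ℂ Gen :=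
  if h : 0 < r then FreeAlgebra.ι ℂ ⟨i, j, ⟨r, h⟩⟩ else if i = j then 1 else 0

/-- The defining relations
`[t_{i,j}^{(r)}, t_{k,l}^{(s)}] = (-1)^{|i||j|+|i||k|+|j||k|}
  ∑_{a=0}^{min(r,s)-1} (t_{k,j}^{(a)} t_{i,l}^{(r+s-1-a)} - t_{k,j}^{(r+s-1-a)} t_{i,l}^{(a)})`,
where `[x, y] = xy - (-1)^{|x||y|} yx`. -/
inductive Rel (p : Fin 2 → ZMod 2) : FreeAlgebra ℂ Gen → FreeAlgebra ℂ Gen → Prop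
  | rtt (i j k l : Fin 2) (r s : ℕ) (hr : 0 < r) (hs : 0 < s) :
      Rel p
        (freeT i j r * freeT k l s
          - sgn ((p i + p j) * (p k + p l)) • (freeT k l s * freeT i j r))
        (sgn (p i * p j + p i * p k + p j * p k) •
          ∑ a ∈ Finset.range (min r s),
            (freeT k j a * freeT i l (r + s - 1 - a) - freeT k j (r + s - 1 - a) * freeT i l a))

/-- The Yangian of `gl_{1|1}` with respect to the parity sequence `p` (with `p 0 ≠ p 1`). -/
def Yangian (p : Fin 2 → ZMod 2) : Type := RingQuot (Rel p)

variable (p : Fin 2 → ZMod 2)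

instance : Ring (Yangian p) := inferInstanceAs (Ring (RingQuot (Rel p)))

instance : Algebra ℂ (Yangian p) := inferInstanceAs (Algebra ℂ (RingQuot (Rel p)))

/-- The quotient map from the free algebra. -/
def mkY : FreeAlgebra ℂ Gen →ₐ[ℂ] Yangian p := RingQuot.mkAlgHom ℂ (Rel p)

/-- The elements `t_{i,j}^{(r)}` of the Yangian, with `t_{i,j}^{(0)} = δ_{i,j}`. -/
def t (i j : Fin 2) (r : ℕ) : Yangian p := mkY p (freeT i j r)

/-- The generator of the Yangian given by a generator symbol. -/
def gen (g : Gen) : Yangian p := t p g.row g.col g.deg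

theorem mkY_ι (g : Gen) : mkY p (FreeAlgebra.ι ℂ g) = gen p g := by
  obtain ⟨i, j, r⟩ := g
  simp only [gen, t, freeT]
  rw [dif_pos r.pos]
  rfl

theorem t_zero (i j : Fin 2) : t p i j 0 = if i = j then 1 else 0 := by
  simp only [t, freeT, lt_irrefl, dite_false]
  split_ifs <;> simp

theorem t_rel (i j k l : Fin 2) (r s : ℕ) (hr : 0 < r) (hs : 0 < s) :
    t p i j r * t p k l s - sgn ((p i + p j) * (p k + p l)) • (t p k l s * t p i j r) =
      sgn (p i * p j + p i * p k + p j * p k) •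
        ∑ a ∈ Finset.range (min r s),
          (t p k j a * t p i l (r + s - 1 - a) - t p k j (r + s - 1 - a) * t p i l a) := by
  have h := RingQuot.mkAlgHom_rel ℂ (Rel.rtt (p := p) i j k l r s hr hs)
  change mkY p _ = mkY p _ at h
  simp only [map_sub, map_mul, map_smul, map_sum] at h
  exact h

section Lift

variable {p} {A : Type*} [Ring A] [Algebra ℂ A]

/-- The family `f` satisfies `f_{i,j}^{(0)} = δ_{i,j}` and the defining relations. -/
structure Satisfies (p : Fin 2 → ZMod 2) (f : Fin 2 → Fin 2 → ℕ → A) : Prop where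
  zero : ∀ i j, f i j 0 = if i = j then 1 else 0
  rel : ∀ i j k l r s, 0 < r → 0 < s →
    f i j r * f k l s - sgn ((p i + p j) * (p k + p l)) • (f k l s * f i j r) =
      sgn (p i * p j + p i * p k + p j * p k) •
        ∑ a ∈ Finset.range (min r s),
          (f k j a * f i l (r + s - 1 - a) - f k j (r + s - 1 - a) * f i l a)

theorem lift_freeT {f : Fin 2 → Fin 2 → ℕ → A} (hf : Satisfies p f) (i j : Fin 2) (r : ℕ) :
    FreeAlgebra.lift ℂ (fun g : Gen => f g.row g.col g.deg) (freeT i j r) = f i j r := by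
  unfold freeT
  split_ifs with h h'
  · simp
  · obtain rfl : r = 0 := by omega
    simp [hf.zero, h']
  · obtain rfl : r = 0 := by omega
    simp [hf.zero, h']

/-- The algebra homomorphism out of the Yangian given by the images of the generators. -/
def liftY (f : Fin 2 → Fin 2 → ℕ → A) (hf : Satisfies p f) : Yangian p →ₐ[ℂ] A :=
  RingQuot.liftAlgHom ℂ ⟨FreeAlgebra.lift ℂ (fun g : Gen => f g.row g.col g.deg), by
    intro x y h
    obtain ⟨i, j, k, l, r, s, hr, hs⟩ := h
    simp only [map_sub, map_mul, map_smul, map_sum, lift_freeT hf]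
    exact hf.rel i j k l r s hr hs⟩

theorem liftY_t (f : Fin 2 → Fin 2 → ℕ → A) (hf : Satisfies p f) (i j : Fin 2) (r : ℕ) :
    liftY f hf (t p i j r) = f i j r := by
  have h := RingQuot.liftAlgHom_mkAlgHom_apply ℂ (s := Rel p)
    (FreeAlgebra.lift ℂ (fun g : Gen => f g.row g.col g.deg)) (by
      intro x y h
      obtain ⟨i, j, k, l, r, s, hr, hs⟩ := h
      simp only [map_sub, map_mul, map_smul, map_sum, lift_freeT hf]
      exact hf.rel i j k l r s hr hs) (freeT i j r)
  rw [lift_freeT hf] at h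
  exact h

theorem hom_ext {F G : Yangian p →ₐ[ℂ] A} (h : ∀ i j r, F (t p i j r) = G (t p i j r)) :
    F = G := by
  have h1 : F.comp (mkY p) = G.comp (mkY p) := by
    ext g
    simp only [Function.comp_apply, AlgHom.coe_comp, mkY_ι]
    exact h _ _ _
  exact RingQuot.ringQuot_ext' (S := ℂ) (s := Rel p) F G h1

end Lift

/-! ### The `ℤ/2`-grading -/

/-- The span of all monomials in the generators of total parity `a`: the homogeneous component of
parity `a` of the Yangian. -/
def part (a : ZMod 2) : Submodule ℂ (Yangian p) :=
  Submodule.span ℂ {x | ∃ w : List Gen, (w.map (Gen.parity p)).sum = a ∧ x = (w.map (gen p)).prod}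

theorem gen_mem (g : Gen) : gen p g ∈ part p (g.parity p) :=
  Submodule.subset_span ⟨[g], by simp, by simp⟩

instance : SetLike.GradedMonoid (part p) where
  one_mem := Submodule.subset_span ⟨[], by simp, by simp⟩
  mul_mem := by
    intro a b x y hx hy
    have h : part p a * part p b ≤ part p (a + b) := by
      unfold part
      rw [Submodule.span_mul_span]
      refine Submodule.span_mono ?_
      rintro _ ⟨_, ⟨w, hw, rfl⟩, _, ⟨w', hw', rfl⟩, rfl⟩
      exact ⟨w ++ w', by simp [hw, hw'], by simp⟩
    exact h (Submodule.mul_mem_mul hx hy)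

theorem t_mem (i j : Fin 2) (r : ℕ) : t p i j r ∈ part p (p i + p j) := by
  rcases Nat.eq_zero_or_pos r with rfl | hr
  · rw [t_zero]
    split_ifs with h
    · subst h
      have h0 : p i + p i = 0 := CharTwo.add_self_eq_zero _
      rw [h0]
      exact SetLike.GradedOne.one_mem
    · exact zero_mem _
  · exact gen_mem p ⟨i, j, ⟨r, hr⟩⟩

/-- The parity automorphism `x ↦ (-1)^{|x|} x`. -/
def parityHom : Yangian p →ₐ[ℂ] Yangian p :=
  liftY (p := p) (fun i j r => sgn (p i + p j) • t p i j r)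
    { zero := by
        intro i j
        rw [t_zero]
        split_ifs with h
        · subst h
          rw [CharTwo.add_self_eq_zero, sgn_zero, one_smul]
        · rw [smul_zero]
      rel := by
        intro i j k l r s hr hs
        have h := congrArg (fun x => (sgn (p i + p j) * sgn (p k + p l)) • x)
          (t_rel p i j k l r s hr hs)
        have e : sgn (p k + p j) * sgn (p i + p l) = sgn (p i + p j) * sgn (p k + p l) := by
          rw [← sgn_add, ← sgn_add]
          congr 1
          ring
        have e2 : ∀ a b c d : Fin 2, ∀ m n : ℕ,
            (sgn (p a + p b) • t p a b m) * (sgn (p c + p d) • t p c d n) =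
              (sgn (p a + p b) * sgn (p c + p d)) • (t p a b m * t p c d n) := by
          intro a b c d m n
          rw [smul_mul_smul_comm]
        simp only [e2, e, ← smul_sub, ← Finset.smul_sum]
        rw [mul_comm (sgn (p k + p l)), smul_comm (sgn ((p i + p j) * (p k + p l))), ← smul_sub, h,
          smul_comm] }

theorem parityHom_t (i j : Fin 2) (r : ℕ) :
    parityHom p (t p i j r) = sgn (p i + p j) • t p i j r :=
  liftY_t _ _ _ _ _

theorem parityHom_of_mem (a : ZMod 2) (x : Yangian p) (hx : x ∈ part p a) :
    parityHom p x = sgn a • x := by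
  induction hx using Submodule.span_induction with
  | mem x h =>
    obtain ⟨w, rfl, rfl⟩ := h
    induction w with
    | nil => simp [sgn_zero]
    | cons g w ih =>
      simp only [List.map_cons, List.prod_cons, List.sum_cons, map_mul, ih, sgn_add]
      rw [show parityHom p (gen p g) = sgn (g.parity p) • gen p g from parityHom_t p _ _ _]
      rw [smul_mul_smul_comm]
  | zero => simp
  | add x y _ _ hx hy => rw [map_add, hx, hy, smul_add]
  | smul c x _ hx => rw [map_smul, hx, smul_comm]

theorem mul_mem_part {a b c : ZMod 2} {x y : Yangian p} (hx : x ∈ part p a) (hy : y ∈ part p b)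
    (h : a + b = c) : x * y ∈ part p c :=
  h ▸ SetLike.GradedMul.mul_mem hx hy

theorem exists_parts (x : Yangian p) :
    ∃ x0 ∈ part p 0, ∃ x1 ∈ part p 1, x = x0 + x1 := by
  obtain ⟨y, rfl⟩ : ∃ y, mkY p y = x := RingQuot.mkAlgHom_surjective ℂ (Rel p) x
  induction y using FreeAlgebra.induction with
  | grade0 r =>
    refine ⟨_, ?_, 0, zero_mem _, (add_zero _).symm⟩
    rw [AlgHom.commutes, Algebra.algebraMap_eq_smul_one]
    exact Submodule.smul_mem _ _ SetLike.GradedOne.one_mem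
  | grade1 g =>
    rw [mkY_ι]
    have h := gen_mem p g
    have h2 : ∀ x : ZMod 2, x = 0 ∨ x = 1 := by decide
    rcases h2 (g.parity p) with h0 | h0 <;> rw [h0] at h
    · exact ⟨_, h, 0, zero_mem _, (add_zero _).symm⟩
    · exact ⟨0, zero_mem _, _, h, (zero_add _).symm⟩
  | add a b ha hb =>
    obtain ⟨a0, ha0, a1, ha1, ha⟩ := ha
    obtain ⟨b0, hb0, b1, hb1, hb⟩ := hb
    refine ⟨a0 + b0, add_mem ha0 hb0, a1 + b1, add_mem ha1 hb1, ?_⟩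
    rw [map_add, ha, hb]
    abel
  | mul a b ha hb =>
    obtain ⟨a0, ha0, a1, ha1, ha⟩ := ha
    obtain ⟨b0, hb0, b1, hb1, hb⟩ := hb
    refine ⟨a0 * b0 + a1 * b1, add_mem (mul_mem_part p ha0 hb0 (by decide))
      (mul_mem_part p ha1 hb1 (by decide)),
      a0 * b1 + a1 * b0, add_mem (mul_mem_part p ha0 hb1 (by decide))
      (mul_mem_part p ha1 hb0 (by decide)), ?_⟩
    rw [map_mul, ha, hb, add_mul, mul_add, mul_add]
    abel

/-- The projection of the Yangian onto its component of parity `a`. -/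
def proj (a : ZMod 2) : Yangian p →ₗ[ℂ] part p a :=
  LinearMap.codRestrict (part p a)
    ((1 / 2 : ℂ) • (LinearMap.id + sgn a • (parityHom p).toLinearMap)) (by
      intro x
      have h2 : ∀ x : ZMod 2, x = 0 ∨ x = 1 := by decide
      obtain ⟨x0, h0, x1, h1, rfl⟩ := exists_parts p x
      simp only [LinearMap.smul_apply, LinearMap.add_apply, LinearMap.id_apply,
        AlgHom.toLinearMap_apply, map_add, parityHom_of_mem p 0 _ h0, parityHom_of_mem p 1 _ h1]
      rcases h2 a with rfl | rfl <;> simp only [sgn_zero, sgn_one]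
      · convert h0 using 1
        module
      · convert h1 using 1
        module)

theorem coe_proj (a : ZMod 2) (x : Yangian p) :
    (proj p a x : Yangian p) = (1 / 2 : ℂ) • (x + sgn a • parityHom p x) := rfl

theorem proj_self (a : ZMod 2) (x : part p a) : proj p a x = x := by
  ext
  rw [coe_proj, parityHom_of_mem p a _ x.2, smul_smul, sgn_mul_self]
  module

theorem proj_ne (a b : ZMod 2) (h : a + b = 1) (x : part p a) : proj p b x = 0 := by
  ext
  rw [coe_proj, parityHom_of_mem p a _ x.2, smul_smul, ← sgn_add, add_comm b a, h, sgn_one,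
    Submodule.coe_zero]
  module

/-- The Yangian is a superalgebra. -/
instance : GradedAlgebra (part p) where
  toDecomposition := DirectSum.Decomposition.ofLinearMap _
    (DirectSum.lof ℂ (ZMod 2) (fun a => part p a) 0 ∘ₗ proj p 0 +
      DirectSum.lof ℂ (ZMod 2) (fun a => part p a) 1 ∘ₗ proj p 1)
    (by
      ext x
      simp only [LinearMap.comp_apply, LinearMap.add_apply, map_add, DirectSum.coeLinearMap_lof,
        coe_proj, sgn_zero, sgn_one, LinearMap.id_apply]
      module)
    (by
      ext a x : 2
      simp only [LinearMap.comp_apply, LinearMap.add_apply, DirectSum.coeLinearMap_lof,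
        LinearMap.id_apply]
      have h2 : ∀ x : ZMod 2, x = 0 ∨ x = 1 := by decide
      rcases h2 a with rfl | rfl
      · rw [proj_self, proj_ne p 0 1 (by decide), map_zero, add_zero]
      · rw [proj_self, proj_ne p 1 0 (by decide), map_zero, zero_add])

/-! ### The comultiplication -/

section Series

open PowerSeries

variable {A : Type*} [Ring A]

/-- A series in the first variable, as a series in two variables. -/
def inX (φ : A⟦X⟧) : (A⟦X⟧)⟦X⟧ := C φ

/-- A series in the second variable, as a series in two variables. -/
def inY (φ : A⟦X⟧) : (A⟦X⟧)⟦X⟧ := PowerSeries.map C φ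

theorem coeff_inX_mul_inY (φ ψ : A⟦X⟧) (r s : ℕ) :
    coeff r (coeff s (inX φ * inY ψ)) = coeff r φ * coeff s ψ := by
  rw [inX, inY, coeff_C_mul, coeff_map, coeff_mul_C]

theorem coeff_inY_mul_inX (φ ψ : A⟦X⟧) (r s : ℕ) :
    coeff r (coeff s (inY ψ * inX φ)) = coeff s ψ * coeff r φ := by
  rw [inX, inY, coeff_mul_C, coeff_map, coeff_C_mul]

/-- The first variable. -/
def vx : (A⟦X⟧)⟦X⟧ := C X

theorem vx_comm (F : (A⟦X⟧)⟦X⟧) : vx * F = F * vx := by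
  ext s r
  rw [vx, coeff_C_mul, coeff_mul_C, X_mul]

theorem coeff_X_vx (F : (A⟦X⟧)⟦X⟧) (r s : ℕ) :
    coeff (r + 1) (coeff (s + 1) (X * (vx * F))) = coeff r (coeff s F) := by
  rw [coeff_succ_X_mul, vx, coeff_C_mul, coeff_succ_X_mul]

variable [Algebra ℂ A]

theorem sum_antisymm (P : ℕ → ℕ → A) (hP : ∀ a b, P a b = -P b a) (r s : ℕ) :
    ∑ a ∈ Finset.range (min r s), P a (r + s - 1 - a) =
      ∑ a ∈ Finset.range r, P a (r + s - 1 - a) := by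
  rcases le_total r s with h | h
  · rw [min_eq_left h]
  · rw [min_eq_right h, ← Finset.sum_range_add_sum_Ico _ h, left_eq_add]
    have e : ∑ a ∈ Finset.Ico s r, P a (r + s - 1 - a) =
        ∑ a ∈ Finset.Ico s r, P (r + s - 1 - a) a := by
      refine Finset.sum_nbij' (fun a => r + s - 1 - a) (fun a => r + s - 1 - a) ?_ ?_ ?_ ?_ ?_
      · intro a ha
        rw [Finset.mem_Ico] at ha ⊢
        omega
      · intro a ha
        rw [Finset.mem_Ico] at ha ⊢
        omega
      · intro a ha
        rw [Finset.mem_Ico] at ha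
        omega
      · intro a ha
        rw [Finset.mem_Ico] at ha
        omega
      · intro a ha
        rw [Finset.mem_Ico] at ha
        congr 1
        omega
    have e2 : ∑ a ∈ Finset.Ico s r, P a (r + s - 1 - a) =
        -∑ a ∈ Finset.Ico s r, P a (r + s - 1 - a) := by
      nth_rewrite 1 [e]
      rw [← Finset.sum_neg_distrib]
      exact Finset.sum_congr rfl fun a _ => hP _ _
    have e3 : (2 : ℂ) • ∑ a ∈ Finset.Ico s r, P a (r + s - 1 - a) = 0 := by
      rw [two_smul]
      nth_rewrite 1 [e2]
      simp
    exact (smul_eq_zero_iff_right two_ne_zero).1 e3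

/-- The defining relations in closed form are equivalent to those in generating series form. -/
theorem closed_iff (c P : ℕ → ℕ → A) (hP : ∀ a b, P a b = -P b a)
    (hc0 : ∀ s, c 0 s = 0) :
    (∀ r s, c r s = ∑ a ∈ Finset.range (min r s), P a (r + s - 1 - a)) ↔
      ∀ r s, c (r + 1) s - c r (s + 1) = P r s := by
  constructor
  · intro h r s
    rw [h, h, sum_antisymm P hP, sum_antisymm P hP, Finset.sum_range_succ]
    have e1 : r + 1 + s - 1 - r = s := by omega
    have e2 : ∀ a, r + 1 + s - 1 - a = r + (s + 1) - 1 - a := by omega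
    rw [e1]
    simp only [e2]
    abel
  · intro h r s
    rw [sum_antisymm P hP]
    induction r generalizing s with
    | zero => simp [hc0]
    | succ r ih =>
      rw [Finset.sum_range_succ, sub_eq_iff_eq_add.1 (h r s), ih (s + 1)]
      have e1 : r + 1 + s - 1 - r = s := by omega
      have e2 : ∀ a, r + 1 + s - 1 - a = r + (s + 1) - 1 - a := by omega
      rw [e1]
      simp only [e2]
      abel

theorem coeff_coeff_smul (z : ℂ) (F : (A⟦X⟧)⟦X⟧) (r s : ℕ) :
    coeff r (coeff s (z • F)) = z • coeff r (coeff s F) := rfl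

theorem comm_zero {f : Fin 2 → Fin 2 → ℕ → A}
    (h0 : ∀ i j, f i j 0 = if i = j then 1 else 0) (i j k l : Fin 2) (s : ℕ) :
    f i j 0 * f k l s - sgn ((p i + p j) * (p k + p l)) • (f k l s * f i j 0) = 0 := by
  rw [h0]
  split_ifs with h
  · subst h
    rw [CharTwo.add_self_eq_zero, zero_mul, sgn_zero]
    simp
  · simp

theorem comm_zero' {f : Fin 2 → Fin 2 → ℕ → A}
    (h0 : ∀ i j, f i j 0 = if i = j then 1 else 0) (i j k l : Fin 2) (r : ℕ) :
    f i j r * f k l 0 - sgn ((p i + p j) * (p k + p l)) • (f k l 0 * f i j r) = 0 := by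
  rw [h0]
  split_ifs with h
  · subst h
    rw [CharTwo.add_self_eq_zero, mul_zero, sgn_zero]
    simp
  · simp

/-- The generating series form of the defining relations. -/
theorem satisfies_iff (f : Fin 2 → Fin 2 → ℕ → A)
    (h0 : ∀ i j, f i j 0 = if i = j then 1 else 0) :
    Satisfies p f ↔ ∀ i j k l,
      ((X : (A⟦X⟧)⟦X⟧) - vx) * (inX (mk (f i j)) * inY (mk (f k l)) -
        sgn ((p i + p j) * (p k + p l)) • (inY (mk (f k l)) * inX (mk (f i j)))) =
      sgn (p i * p j + p i * p k + p j * p k) • (X * (vx *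
        (inX (mk (f k j)) * inY (mk (f i l)) - inY (mk (f k j)) * inX (mk (f i l))))) := by
  have key : ∀ i j k l, (∀ r s, 0 < r → 0 < s →
      f i j r * f k l s - sgn ((p i + p j) * (p k + p l)) • (f k l s * f i j r) =
      sgn (p i * p j + p i * p k + p j * p k) •
        ∑ a ∈ Finset.range (min r s),
          (f k j a * f i l (r + s - 1 - a) - f k j (r + s - 1 - a) * f i l a)) ↔
      ∀ r s, (f i j (r + 1) * f k l s -
          sgn ((p i + p j) * (p k + p l)) • (f k l s * f i j (r + 1))) -
        (f i j r * f k l (s + 1) -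
          sgn ((p i + p j) * (p k + p l)) • (f k l (s + 1) * f i j r)) =
        sgn (p i * p j + p i * p k + p j * p k) • (f k j r * f i l s - f k j s * f i l r) := by
    intro i j k l
    rw [← closed_iff
      (fun r s => f i j r * f k l s - sgn ((p i + p j) * (p k + p l)) • (f k l s * f i j r))
      (fun r s => sgn (p i * p j + p i * p k + p j * p k) • (f k j r * f i l s - f k j s * f i l r))
      (by intro a b; module) (fun s => comm_zero p h0 i j k l s)]
    simp only [← Finset.smul_sum]
    constructor
    · intro h r s
      rcases Nat.eq_zero_or_pos r with rfl | hr
      · rw [comm_zero p h0]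
        simp
      rcases Nat.eq_zero_or_pos s with rfl | hs
      · rw [comm_zero' p h0]
        simp
      exact h r s hr hs
    · intro h r s _ _
      exact h r s
  have key2 : Satisfies p f ↔ ∀ i j k l, ∀ r s, 0 < r → 0 < s →
      f i j r * f k l s - sgn ((p i + p j) * (p k + p l)) • (f k l s * f i j r) =
      sgn (p i * p j + p i * p k + p j * p k) •
        ∑ a ∈ Finset.range (min r s),
          (f k j a * f i l (r + s - 1 - a) - f k j (r + s - 1 - a) * f i l a) :=
    ⟨fun h => h.rel, fun h => ⟨h0, h⟩⟩
  rw [key2]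
  refine forall_congr' fun i => forall_congr' fun j => forall_congr' fun k =>
    forall_congr' fun l => ?_
  rw [key]
  constructor
  · intro h
    ext s r
    rw [sub_mul, map_sub, map_sub, coeff_coeff_smul]
    rcases s with _ | s
    · rw [coeff_zero_X_mul, coeff_zero_X_mul, vx, coeff_C_mul]
      rcases r with _ | r
      · simp
      · rw [coeff_succ_X_mul, map_sub, map_sub, coeff_coeff_smul, coeff_inX_mul_inY,
          coeff_inY_mul_inX]
        simp only [coeff_mk]
        rw [comm_zero' p h0]
        simp
    · rcases r with _ | r
      · rw [coeff_succ_X_mul, map_sub, map_sub, coeff_coeff_smul, coeff_inX_mul_inY,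
          coeff_inY_mul_inX, vx, coeff_C_mul, coeff_zero_X_mul, coeff_succ_X_mul, coeff_C_mul,
          coeff_zero_X_mul]
        simp only [coeff_mk]
        rw [comm_zero p h0]
        simp
      · rw [coeff_X_vx, coeff_succ_X_mul, vx, coeff_C_mul, coeff_succ_X_mul]
        simp only [map_sub, coeff_coeff_smul, coeff_inX_mul_inY, coeff_inY_mul_inX, coeff_mk]
        exact h r s
  · intro h r s
    have h1 := congrArg (fun F => coeff (r + 1) (coeff (s + 1) F)) h
    simp only [sub_mul] at h1
    rw [map_sub, map_sub, coeff_coeff_smul, coeff_X_vx, coeff_succ_X_mul, vx, coeff_C_mul,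
      coeff_succ_X_mul] at h1
    simp only [map_sub, coeff_coeff_smul, coeff_inX_mul_inY, coeff_inY_mul_inX, coeff_mk] at h1
    exact h1

/-- The generating series form of the relations is preserved by super matrix multiplication. -/
theorem rtt_mul {R : Type*} [Ring R] [Algebra ℂ R] (z w : R)
    (hz : ∀ x, z * x = x * z) (hw : ∀ x, w * x = x * w)
    (a a' b b' : Fin 2 → Fin 2 → R)
    (ha : ∀ i j k l, z * (a i j * a' k l - sgn ((p i + p j) * (p k + p l)) • (a' k l * a i j)) =
      sgn (p i * p j + p i * p k + p j * p k) • (w * (a k j * a' i l - a' k j * a i l)))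
    (hb : ∀ i j k l, z * (b i j * b' k l - sgn ((p i + p j) * (p k + p l)) • (b' k l * b i j)) =
      sgn (p i * p j + p i * p k + p j * p k) • (w * (b k j * b' i l - b' k j * b i l)))
    (hba : ∀ i j k l, b i j * a' k l = sgn ((p i + p j) * (p k + p l)) • (a' k l * b i j))
    (hba' : ∀ i j k l, b' i j * a k l = sgn ((p i + p j) * (p k + p l)) • (a k l * b' i j))
    (i j m l : Fin 2) :
    z * ((∑ h, a i h * b h j) * (∑ k, a' m k * b' k l) -
      sgn ((p i + p j) * (p m + p l)) • ((∑ k, a' m k * b' k l) * (∑ h, a i h * b h j))) =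
    sgn (p i * p j + p i * p m + p j * p m) • (w * ((∑ h, a m h * b h j) * (∑ k, a' i k * b' k l) -
      (∑ h, a' m h * b' h j) * (∑ k, a i k * b k l))) := by
  have h2 : (2 : ZMod 2) = 0 := rfl
  have sg : ∀ a b c d : ZMod 2, a + b = c + d → sgn a * sgn b = sgn c * sgn d := by
    intro a b c d h
    rw [← sgn_add, ← sgn_add, h]
  let S : Fin 2 → Fin 2 → ℂ := fun h k =>
    sgn (p h * p k + p j * p m + p j * p k + p i * p h + p i * p m)
  let al : Fin 2 → Fin 2 → R := fun h k => w * (a m h * a' i k * (b h j * b' k l))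
  let be : Fin 2 → Fin 2 → R := fun h k => w * (a' m h * a i k * (b' h j * b k l))
  let ga : Fin 2 → Fin 2 → R := fun h k => w * (a' m h * a i k * (b h j * b' k l))
  have expand : ∀ h k, z * (a i h * b h j * (a' m k * b' k l) -
      sgn ((p i + p j) * (p m + p l)) • (a' m k * b' k l * (a i h * b h j))) =
      S h k • (al h k - ga h k) + S k h • (ga k h - be k h) := by
    intro h k
    have e1 : a i h * b h j * (a' m k * b' k l) =
        sgn ((p h + p j) * (p m + p k)) • (a i h * a' m k * (b h j * b' k l)) := by
      rw [mul_assoc, ← mul_assoc (b h j), hba, smul_mul_assoc, mul_smul_comm]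
      simp only [mul_assoc]
    have e2 : a' m k * b' k l * (a i h * b h j) =
        sgn ((p k + p l) * (p i + p h)) • (a' m k * a i h * (b' k l * b h j)) := by
      rw [mul_assoc, ← mul_assoc (b' k l), hba', smul_mul_assoc, mul_smul_comm]
      simp only [mul_assoc]
    have e3 : z * (a i h * b h j * (a' m k * b' k l) -
        sgn ((p i + p j) * (p m + p l)) • (a' m k * b' k l * (a i h * b h j))) =
        sgn ((p h + p j) * (p m + p k)) •
          (z * (a i h * a' m k - sgn ((p i + p h) * (p m + p k)) • (a' m k * a i h)) *
            (b h j * b' k l)) +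
        sgn ((p i + p j) * (p m + p k)) • (a' m k * a i h *
          (z * (b h j * b' k l - sgn ((p h + p j) * (p k + p l)) • (b' k l * b h j)))) := by
      have s1 : sgn ((p i + p j) * (p m + p l)) * sgn ((p k + p l) * (p i + p h)) =
          sgn ((p i + p j) * (p m + p k)) * sgn ((p h + p j) * (p k + p l)) := by
        apply sg
        linear_combination (p i * p l - p j * p k) * h2
      have s2 : sgn ((p h + p j) * (p m + p k)) * sgn ((p i + p h) * (p m + p k)) =
          sgn ((p i + p j) * (p m + p k)) := by
        rw [← sgn_add]
        congr 1
        linear_combination (p h * p m + p h * p k) * h2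
      rw [e1, e2, smul_smul, s1, ← mul_assoc (a' m k * a i h) z, ← hz (a' m k * a i h)]
      simp only [mul_sub, sub_mul, smul_sub, mul_smul_comm, smul_mul_assoc, smul_smul, s2,
        ← mul_assoc]
      abel
    have t1 : sgn ((p h + p j) * (p m + p k)) * sgn (p i * p h + p i * p m + p h * p m) = S h k := by
      rw [← sgn_add]
      congr 1
      linear_combination (p h * p m) * h2
    have t2 : sgn ((p i + p j) * (p m + p k)) * sgn (p h * p j + p h * p k + p j * p k) = S k h := by
      rw [← sgn_add]
      congr 1
      linear_combination (p j * p k) * h2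
    rw [e3, ha, hb, mul_smul_comm, smul_mul_assoc, smul_smul, smul_smul, t1, t2,
      ← mul_assoc (a' m k * a i h) w, ← hw (a' m k * a i h)]
    simp only [al, be, ga, mul_sub, sub_mul, mul_assoc]
  have expand2 : ∀ h k, sgn (p i * p j + p i * p m + p j * p m) •
      (w * (a m h * b h j * (a' i k * b' k l) - a' m h * b' h j * (a i k * b k l))) =
      S h k • (al h k - be h k) := by
    intro h k
    have e1 : a m h * b h j * (a' i k * b' k l) =
        sgn ((p h + p j) * (p i + p k)) • (a m h * a' i k * (b h j * b' k l)) := by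
      rw [mul_assoc, ← mul_assoc (b h j), hba, smul_mul_assoc, mul_smul_comm]
      simp only [mul_assoc]
    have e2 : a' m h * b' h j * (a i k * b k l) =
        sgn ((p h + p j) * (p i + p k)) • (a' m h * a i k * (b' h j * b k l)) := by
      rw [mul_assoc, ← mul_assoc (b' h j), hba', smul_mul_assoc, mul_smul_comm]
      simp only [mul_assoc]
    have t1 : sgn (p i * p j + p i * p m + p j * p m) * sgn ((p h + p j) * (p i + p k)) =
        S h k := by
      rw [← sgn_add]
      congr 1
      linear_combination (p i * p j) * h2
    rw [e1, e2, ← smul_sub, mul_smul_comm, smul_smul, t1, mul_sub]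
  have L : z * ((∑ h, a i h * b h j) * (∑ k, a' m k * b' k l) -
      sgn ((p i + p j) * (p m + p l)) • ((∑ k, a' m k * b' k l) * (∑ h, a i h * b h j))) =
      ∑ h, ∑ k, z * (a i h * b h j * (a' m k * b' k l) -
      sgn ((p i + p j) * (p m + p l)) • (a' m k * b' k l * (a i h * b h j))) := by
    simp only [Fin.sum_univ_two, mul_add, add_mul, mul_sub, smul_add, smul_sub]
    abel
  have M : sgn (p i * p j + p i * p m + p j * p m) •
      (w * ((∑ h, a m h * b h j) * (∑ k, a' i k * b' k l) -
      (∑ h, a' m h * b' h j) * (∑ k, a i k * b k l))) =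
      ∑ h, ∑ k, sgn (p i * p j + p i * p m + p j * p m) •
      (w * (a m h * b h j * (a' i k * b' k l) - a' m h * b' h j * (a i k * b k l))) := by
    simp only [Fin.sum_univ_two, mul_add, add_mul, mul_sub, smul_add, smul_sub]
    abel
  rw [L, M]
  simp only [expand, expand2, Finset.sum_add_distrib]
  rw [Finset.sum_comm (f := fun h k => S k h • (ga k h - be k h)), ← Finset.sum_add_distrib]
  simp only [← Finset.sum_add_distrib]
  refine Finset.sum_congr rfl fun h _ => Finset.sum_congr rfl fun k _ => ?_
  rw [← smul_add]
  congr 1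
  abel

end Series

/-- The tensor square `Y ⊗ Y` of the Yangian in the category of superalgebras, with multiplication
`(a ⊗ b)(c ⊗ d) = (-1)^{|b||c|} ac ⊗ bd`. -/
abbrev YY : Type := part p ᵍ⊗[ℂ] part p

theorem satisfies_t : Satisfies p (t p) := ⟨t_zero p, t_rel p⟩

theorem Satisfies.map {A B : Type*} [Ring A] [Algebra ℂ A] [Ring B] [Algebra ℂ B]
    {f : Fin 2 → Fin 2 → ℕ → A} (hf : Satisfies p f) (F : A →ₐ[ℂ] B) :
    Satisfies p (fun i j r => F (f i j r)) where
  zero i j := by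
    rw [hf.zero]
    split_ifs <;> simp
  rel i j k l r s hr hs := by
    have h := congrArg F (hf.rel i j k l r s hr hs)
    simpa only [map_sub, map_mul, map_smul, map_sum] using h

theorem units_smul (a : ZMod 2) (x : YY p) : (-1 : ℤˣ) ^ a • x = sgn a • x := by
  have h2 : ∀ x : ZMod 2, x = 0 ∨ x = 1 := by decide
  rcases h2 a with rfl | rfl
  · rw [sgn_zero, uzpow_zero, one_smul, one_smul]
  · rw [sgn_one, uzpow_one, Units.neg_smul, one_smul, neg_smul, one_smul]

/-- `∑_h ∑_{a+b=r} t_{i,h}^{(a)} ⊗ t_{h,j}^{(b)}`, the coefficient of `u^{-r}` in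
`∑_h t_{i,h}(u) ⊗ t_{h,j}(u)`. -/
def comulT (i j : Fin 2) (r : ℕ) : YY p :=
  ∑ h : Fin 2, ∑ ab ∈ Finset.HasAntidiagonal.antidiagonal r, t p i h ab.1 ᵍ⊗ₜ[ℂ] t p h j ab.2

/-- `t_{i,j}^{(r)} ⊗ 1`. -/
def tL (i j : Fin 2) (r : ℕ) : YY p :=
  GradedTensorProduct.includeLeft (part p) (part p) (t p i j r)

/-- `1 ⊗ t_{i,j}^{(r)}`. -/
def tR (i j : Fin 2) (r : ℕ) : YY p :=
  GradedTensorProduct.includeRight (part p) (part p) (t p i j r)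

theorem tL_mul_tR (i j k l : Fin 2) (r s : ℕ) :
    tL p i j r * tR p k l s = t p i j r ᵍ⊗ₜ[ℂ] t p k l s := by
  simp only [tL, tR, GradedTensorProduct.includeLeft_apply, GradedTensorProduct.includeRight_apply]
  exact GradedTensorProduct.tmul_one_mul_one_tmul _ _ _ _

theorem tR_mul_tL (i j k l : Fin 2) (r s : ℕ) :
    tR p i j r * tL p k l s = sgn ((p i + p j) * (p k + p l)) • (tL p k l s * tR p i j r) := by
  rw [tL_mul_tR]
  simp only [tL, tR, GradedTensorProduct.includeLeft_apply, GradedTensorProduct.includeRight_apply]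
  have h := GradedTensorProduct.tmul_coe_mul_coe_tmul (R := ℂ) (part p) (part p) 1
    ⟨t p i j r, t_mem p i j r⟩ ⟨t p k l s, t_mem p k l s⟩ 1
  rw [one_mul, mul_one, units_smul] at h
  exact h

open PowerSeries in
theorem satisfies_comulT : Satisfies p (comulT p) := by
  have hz : ∀ i j, comulT p i j 0 = if i = j then 1 else 0 := by
    intro i j
    simp only [comulT, Finset.Nat.antidiagonal_zero, Finset.sum_singleton, ← tL_mul_tR]
    simp only [tL, tR, t_zero, Fin.sum_univ_two]
    fin_cases i <;> fin_cases j <;>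
      simp [-GradedTensorProduct.includeLeft_apply, -GradedTensorProduct.includeRight_apply]
  rw [satisfies_iff p _ hz]
  have hL := (satisfies_iff p _ ((satisfies_t p).map p
    (GradedTensorProduct.includeLeft (part p) (part p))).zero).1 ((satisfies_t p).map p _)
  have hR := (satisfies_iff p _ ((satisfies_t p).map p
    (GradedTensorProduct.includeRight (part p) (part p))).zero).1 ((satisfies_t p).map p _)
  have e : ∀ i j, mk (comulT p i j) = ∑ h, mk (tL p i h) * mk (tR p h j) := by
    intro i j
    ext r
    simp only [map_sum, coeff_mul, coeff_mk, tL_mul_tR]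
    rfl
  have eX : ∀ i j, inX (mk (comulT p i j)) = ∑ h, inX (mk (tL p i h)) * inX (mk (tR p h j)) := by
    intro i j
    simp only [e, inX, map_sum, map_mul]
  have eY : ∀ i j, inY (mk (comulT p i j)) = ∑ h, inY (mk (tL p i h)) * inY (mk (tR p h j)) := by
    intro i j
    simp only [e, inY, map_sum, map_mul]
  intro i j k l
  simp only [eX, eY]
  have c1 : ∀ F : (YY p)⟦X⟧⟦X⟧, (X - vx) * F = F * (X - vx) := by
    intro F
    rw [sub_mul, mul_sub, vx_comm, X_mul]
  have c2 : ∀ F : (YY p)⟦X⟧⟦X⟧, (X * vx) * F = F * (X * vx) := by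
    intro F
    rw [mul_assoc, vx_comm, ← mul_assoc, X_mul, mul_assoc, X_mul]
  have := rtt_mul p (X - vx) (X * vx) c1 c2 (fun i j => inX (mk (tL p i j)))
    (fun i j => inY (mk (tL p i j))) (fun i j => inX (mk (tR p i j)))
    (fun i j => inY (mk (tR p i j)))
    (by intro i j k l; rw [mul_assoc]; exact hL i j k l)
    (by intro i j k l; rw [mul_assoc]; exact hR i j k l)
    (by
      intro i j k l
      ext s r
      rw [coeff_coeff_smul, coeff_inX_mul_inY, coeff_inY_mul_inX]
      simp only [coeff_mk, tR_mul_tL])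
    (by
      intro i j k l
      ext s r
      rw [coeff_coeff_smul, coeff_inX_mul_inY, coeff_inY_mul_inX]
      simp only [coeff_mk, tR_mul_tL])
    i j k l
  rw [mul_assoc X] at this
  exact this

/-- The comultiplication `Δ : Y → Y ⊗ Y`, the homomorphism of superalgebras with
`Δ(t_{i,j}(u)) = ∑_h t_{i,h}(u) ⊗ t_{h,j}(u)`. -/
def comul : Yangian p →ₐ[ℂ] YY p := liftY (comulT p) (satisfies_comulT p)

theorem comul_t (i j : Fin 2) (r : ℕ) :
    comul p (t p i j r) =
      ∑ h : Fin 2, ∑ ab ∈ Finset.HasAntidiagonal.antidiagonal r, t p i h ab.1 ᵍ⊗ₜ[ℂ] t p h j ab.2 :=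
  liftY_t _ _ _ _ _

/-! ### The Drinfeld generators -/

open PowerSeries

/-- `t_{i,j}(u)`. Formal power series in `u⁻¹` are power series in the variable `X = u⁻¹`. -/
def tSeries (i j : Fin 2) : (Yangian p)⟦X⟧ := mk (t p i j)

/-- The inverse of a formal series with constant coefficient `1`. -/
def seriesInv {A : Type*} [Ring A] (φ : A⟦X⟧) : A⟦X⟧ := invOfUnit φ 1

/-- `d_1(u) = t_{1,1}(u)`. -/
def d₁ : (Yangian p)⟦X⟧ := tSeries p 0 0

/-- `d_2(u) = t_{2,2}(u) - t_{2,1}(u) t_{1,1}(u)⁻¹ t_{1,2}(u)`. -/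
def d₂ : (Yangian p)⟦X⟧ :=
  tSeries p 1 1 - tSeries p 1 0 * seriesInv (tSeries p 0 0) * tSeries p 0 1

/-- `e(u) = t_{1,1}(u)⁻¹ t_{1,2}(u)`. -/
def e : (Yangian p)⟦X⟧ := seriesInv (tSeries p 0 0) * tSeries p 0 1

/-- `f(u) = t_{2,1}(u) t_{1,1}(u)⁻¹`. -/
def f : (Yangian p)⟦X⟧ := tSeries p 1 0 * seriesInv (tSeries p 0 0)

/-- `d̃_1(u) = d_1(u)⁻¹`. -/
def dt₁ : (Yangian p)⟦X⟧ := seriesInv (d₁ p)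

/-- `d̃_2(u) = d_2(u)⁻¹`. -/
def dt₂ : (Yangian p)⟦X⟧ := seriesInv (d₂ p)

theorem constantCoeff_tSeries (i j : Fin 2) :
    constantCoeff (tSeries p i j) = if i = j then 1 else 0 := by
  rw [tSeries, ← coeff_zero_eq_constantCoeff_apply, coeff_mk, t_zero]

theorem constantCoeff_d₁ : constantCoeff (d₁ p) = 1 := by
  rw [d₁, constantCoeff_tSeries, if_pos rfl]

theorem constantCoeff_d₂ : constantCoeff (d₂ p) = 1 := by
  simp [d₂, constantCoeff_tSeries]

theorem d₁_mul_dt₁ : d₁ p * dt₁ p = 1 := mul_invOfUnit _ _ (constantCoeff_d₁ p)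

theorem dt₁_mul_d₁ : dt₁ p * d₁ p = 1 := invOfUnit_mul _ _ (constantCoeff_d₁ p)

theorem d₂_mul_dt₂ : d₂ p * dt₂ p = 1 := mul_invOfUnit _ _ (constantCoeff_d₂ p)

theorem dt₂_mul_d₂ : dt₂ p * d₂ p = 1 := invOfUnit_mul _ _ (constantCoeff_d₂ p)

/-- The Gauss factorization `T(u) = F(u) D(u) E(u)`. -/
theorem gauss_factorization :
    !![tSeries p 0 0, tSeries p 0 1; tSeries p 1 0, tSeries p 1 1] =
      !![1, 0; f p, 1] * !![d₁ p, 0; 0, d₂ p] * !![1, e p; 0, 1] := by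
  have h1 : tSeries p 0 0 * seriesInv (tSeries p 0 0) = 1 := d₁_mul_dt₁ p
  have h2 : seriesInv (tSeries p 0 0) * tSeries p 0 0 = 1 := dt₁_mul_d₁ p
  have h3 : d₁ p * e p = tSeries p 0 1 := by rw [d₁, e, ← mul_assoc, h1, one_mul]
  have h4 : f p * d₁ p = tSeries p 1 0 := by rw [d₁, f, mul_assoc, h2, mul_one]
  have h5 : tSeries p 1 0 * e p + d₂ p = tSeries p 1 1 := by
    rw [e, d₂, ← mul_assoc]
    abel
  simp [h3, h4, h5]
  rfl

/-! ### Series with coefficients in the tensor square -/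

variable {p}

/-- `a(u) ⊗ b(u) = ∑_{r,s} a^{(r)} ⊗ b^{(s)} u^{-r-s}`. -/
def tens (a b : (Yangian p)⟦X⟧) : (YY p)⟦X⟧ :=
  mk fun n => ∑ rs ∈ Finset.HasAntidiagonal.antidiagonal n, coeff rs.1 a ᵍ⊗ₜ[ℂ] coeff rs.2 b

/-- `Δ(a(u)) = ∑_r Δ(a^{(r)}) u^{-r}`. -/
def comulSeries (a : (Yangian p)⟦X⟧) : (YY p)⟦X⟧ := mk fun r => comul p (coeff r a)

/-- A family of formal series is summable if for every `m` only finitely many of its members have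
a nonzero coefficient in degree `m`. -/
def FormallySummable {ι A : Type*} [Ring A] (g : ι → A⟦X⟧) : Prop :=
  ∀ m, {n | coeff m (g n) ≠ 0}.Finite

/-- The sum, coefficient by coefficient, of a summable family of formal series. -/
def formalSum {ι A : Type*} [Ring A] (g : ι → A⟦X⟧) : A⟦X⟧ := mk fun m => ∑ᶠ n, coeff m (g n)

end SuperYangian

end

open SuperYangian

noncomputable section

namespace SuperYangian

open PowerSeries

/-! ### Formal geometric series -/

section Geometric

variable {A : Type*} [Ring A]

/-! Write `T(u)` for the matrix of the `t_{i,j}(u)`. The comultiplication reads `Δ(T) = (T ⊗ 1)(1 ⊗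
T)`, and both factors have a Gauss factorization: `F D E` and `F' D' E'`, say. The theorem is the
Gauss factorization of the product `F D (E F') D' E'`.

Put `x = e ⊗ 1` and `y = 1 ⊗ f`. The corner of `E F'` is `1 + xy`; with `v = (1 + xy)⁻¹`,
`gauss_factors_mul` gives, in any ring, `Δ(d̃₁) = d̃₁' v d̃₁`, `Δ(e) = e' + d̃₁' v x d₂'`, `Δ(f) = f
+ d₂ y v d̃₁`, `Δ(d₂) = d₂ (1 - y v x) d₂'`, where a prime marks the second tensor factor.

Since `|1| ≠ |2|`, both `x` and `y` are odd, so `yx = -xy`. Hence `1 - y v x = (1 + yx)⁻¹ = (1 -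
xy)⁻¹`, and inverting `Δ(d₂)` leaves just two terms for `Δ(d̃₂)`. The other formulas come from
expanding `v` and `(1 - xy)⁻¹` as geometric series (`geometric_formalSum`), which converge because
`e(u)` has no constant term. Sorting `(xy)^n` into `x^n y^n` costs `(-1)^(n(n-1)/2) = (-1)^⌊n/2⌋`;
the expansion in `-xy` turns this into `(-1)^⌈n/2⌉`. The even factors `d₁, d̃₁, d̃₂` cross the
tensor sign without any sign. -/

theorem coeff_formalSum_of_dvd {g : ℕ → A⟦X⟧} (hg : ∀ n, X ^ n ∣ g n) (m : ℕ) :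
    coeff m (formalSum g) = coeff m (∑ n ∈ Finset.range (m + 1), g n) := by
  rw [formalSum, coeff_mk, map_sum]
  refine finsum_eq_sum_of_support_subset _ fun n hn => ?_
  by_contra h
  rw [Finset.mem_coe, Finset.mem_range, not_lt] at h
  exact hn (X_pow_dvd_iff.1 (hg n) m h)

theorem formallySummable_of_dvd {g : ℕ → A⟦X⟧} (hg : ∀ n, X ^ n ∣ g n) :
    FormallySummable g := by
  intro m
  refine (Set.finite_Iic m).subset fun n hn => ?_
  by_contra h
  exact hn (X_pow_dvd_iff.1 (hg n) m (not_le.1 h))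

theorem X_pow_dvd_mul_mul {n : ℕ} {φ : A⟦X⟧} (h : X ^ n ∣ φ) (a b : A⟦X⟧) :
    X ^ n ∣ a * φ * b := by
  obtain ⟨ψ, rfl⟩ := h
  exact ⟨a * ψ * b, by rw [← mul_assoc a, (commute_X_pow a n).eq]; simp only [mul_assoc]⟩

theorem X_pow_dvd_pow {φ : A⟦X⟧} (h : X ∣ φ) (n : ℕ) : X ^ n ∣ φ ^ n := by
  obtain ⟨ψ, rfl⟩ := h
  exact ⟨ψ ^ n, ((commute_X ψ).symm).mul_pow n⟩

/-- Truncating the geometric series for `v = (1 - w)⁻¹` leaves a remainder `v w^(m+1)`, which is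
invisible in degree `m`. The terms `g n` are a separate argument so that they can be supplied
already sorted and signed. -/
theorem geometric_formalSum (a b : A⟦X⟧) {w v : A⟦X⟧} (hw : X ∣ w) (hv : v * (1 - w) = 1)
    {g : ℕ → A⟦X⟧} (hg : ∀ n, a * w ^ n * b = g n) :
    FormallySummable g ∧ a * v * b = formalSum g := by
  have hd : ∀ n, X ^ n ∣ g n := fun n => hg n ▸ X_pow_dvd_mul_mul (X_pow_dvd_pow hw n) a b
  refine ⟨formallySummable_of_dvd hd, ?_⟩
  ext m
  rw [coeff_formalSum_of_dvd hd, ← sub_eq_zero, ← map_sub]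
  -- Multiply `(1 - w) ∑ w^n = 1 - w^(m+1)` on the left by `v`.
  have h1 : v = ∑ n ∈ Finset.range (m + 1), w ^ n + v * w ^ (m + 1) := by
    have h := congrArg (v * ·) (mul_neg_geom_sum w (m + 1))
    simp only [← mul_assoc, hv, one_mul, mul_sub, mul_one] at h
    rw [h, sub_add_cancel]
  have h2 : a * v * b - ∑ n ∈ Finset.range (m + 1), g n = a * v * w ^ (m + 1) * b := by
    simp only [← hg, ← Finset.sum_mul, ← Finset.mul_sum]
    nth_rewrite 1 [h1]
    noncomm_ring
  rw [h2]
  exact X_pow_dvd_iff.1 (X_pow_dvd_mul_mul (X_pow_dvd_pow hw (m + 1)) _ _) m m.lt_succ_self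

/-- The sums for `Δ(e)` and `Δ(f)` start at `n = 1`, whereas geometric series start at `0`; this is
the shift between the two. -/
theorem formalSum_pnat {g : ℕ+ → A⟦X⟧}
    (h : FormallySummable fun n : ℕ => g n.succPNat) :
    FormallySummable g ∧ formalSum (fun n : ℕ => g n.succPNat) = formalSum g := by
  constructor
  · intro m
    refine ((h m).image Nat.succPNat).subset fun n hn => ⟨n.natPred, ?_, n.succPNat_natPred⟩
    simpa using hn
  · ext m
    simp only [formalSum, coeff_mk]
    exact finsum_comp_equiv Equiv.pnatEquivNat.symm (f := fun n => coeff m (g n))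

end Geometric

/-! ### Noncommutative algebra behind the formulas -/

section Anticommuting

variable {R : Type*} [Ring R] [Algebra ℂ R] {x y : R}

theorem anticommute_pow (h : y * x = -(x * y)) (n : ℕ) :
    y ^ n * x = (-1 : ℂ) ^ n • (x * y ^ n) := by
  induction n with
  | zero => simp
  | succ n ih =>
    rw [pow_succ, mul_assoc, h, mul_neg, ← mul_assoc, ih, pow_succ (-1 : ℂ), mul_neg_one,
      neg_smul, smul_mul_assoc, mul_assoc]

theorem neg_one_pow_eq_of_even {m n : ℕ} (h : Even (m + n)) : (-1 : ℂ) ^ m = (-1) ^ n := by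
  rw [neg_one_pow_eq_pow_mod_two, neg_one_pow_eq_pow_mod_two (n := n)]
  congr 1
  rw [Nat.even_iff] at h
  omega

/-- The last `x` in `(xy)^(n+1)` crosses `y^n` and contributes `(-1)^n`. The accumulated exponent
`n(n-1)/2` has the parity of `⌊n/2⌋`. -/
theorem mul_pow_of_anticommute (h : y * x = -(x * y)) (n : ℕ) :
    (x * y) ^ n = (-1 : ℂ) ^ (n / 2) • (x ^ n * y ^ n) := by
  induction n with
  | zero => simp
  | succ n ih =>
    have e : (-1 : ℂ) ^ ((n + 1) / 2) = (-1) ^ (n / 2 + n) := by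
      apply neg_one_pow_eq_of_even
      rw [Nat.even_iff]
      obtain ⟨k, rfl | rfl⟩ := n.even_or_odd' <;> omega
    rw [pow_succ, ih, smul_mul_assoc, mul_assoc, ← mul_assoc (y ^ n), anticommute_pow h,
      smul_mul_assoc, mul_smul_comm, smul_smul, ← pow_add, e, pow_succ x, pow_succ y]
    simp only [mul_assoc]

theorem neg_mul_pow_of_anticommute (h : y * x = -(x * y)) (n : ℕ) :
    (-(x * y)) ^ n = (-1 : ℂ) ^ (n ⌈/⌉ 2) • (x ^ n * y ^ n) := by
  -- Since `⌊n/2⌋ + ⌈n/2⌉ = n`, the exponents `n + ⌊n/2⌋` and `⌈n/2⌉` agree mod 2.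
  have e : (-1 : ℂ) ^ (n ⌈/⌉ 2) = (-1) ^ (n + n / 2) := by
    apply neg_one_pow_eq_of_even
    rw [Nat.even_iff, Nat.ceilDiv_eq_add_pred_div]
    obtain ⟨k, rfl | rfl⟩ := n.even_or_odd' <;> omega
  have e2 : (-(x * y)) ^ n = (-1 : ℂ) ^ n • (x * y) ^ n := by
    rw [← smul_pow, neg_one_smul]
  rw [e2, mul_pow_of_anticommute h, smul_smul, ← pow_add, e]

/-- Holds because `⌈(n+1)/2⌉ = ⌊n/2⌋ + 1`. -/
theorem neg_one_pow_succ_ceilDiv_two (n : ℕ) :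
    -(-1 : ℂ) ^ ((n + 1) ⌈/⌉ 2) = (-1) ^ (n / 2) := by
  rw [← mul_neg_one, ← pow_succ]
  apply neg_one_pow_eq_of_even
  rw [Nat.even_iff, Nat.ceilDiv_eq_add_pred_div]
  omega

/-- The extra `x` crosses `y^n`, changing the sign exponent from `⌈n/2⌉` to `⌊n/2⌋` mod 2. The sign
is written in terms of `n + 1`, the summation index in `Δ(e)`. -/
theorem neg_mul_pow_mul_of_anticommute (h : y * x = -(x * y)) (n : ℕ) :
    (-(x * y)) ^ n * x = -(-1 : ℂ) ^ ((n + 1) ⌈/⌉ 2) • (x ^ (n + 1) * y ^ n) := by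
  have e : (-1 : ℂ) ^ (n / 2) = (-1) ^ (n ⌈/⌉ 2 + n) := by
    apply neg_one_pow_eq_of_even
    rw [Nat.even_iff, Nat.ceilDiv_eq_add_pred_div]
    obtain ⟨k, rfl | rfl⟩ := n.even_or_odd' <;> omega
  rw [neg_mul_pow_of_anticommute h, smul_mul_assoc, mul_assoc, anticommute_pow h, mul_smul_comm,
    smul_smul, ← pow_add, ← e, neg_one_pow_succ_ceilDiv_two, pow_succ, mul_assoc]

theorem mul_neg_mul_pow_of_anticommute (h : y * x = -(x * y)) (n : ℕ) :
    y * (-(x * y)) ^ n = -(-1 : ℂ) ^ ((n + 1) ⌈/⌉ 2) • (x ^ n * y ^ (n + 1)) := by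
  have e : y * (-(x * y)) ^ n = (x * y) ^ n * y := by
    -- Moving `y` through one factor `-(xy)` absorbs its sign, so `y (-(xy))^n = (xy)^n y`.
    have hs : SemiconjBy y (-(x * y)) (x * y) := by
      rw [SemiconjBy, mul_neg, ← mul_assoc, h, neg_mul, neg_neg]
    exact (hs.pow_right n).eq
  rw [e, mul_pow_of_anticommute h, smul_mul_assoc, neg_one_pow_succ_ceilDiv_two, pow_succ y,
    mul_assoc]

end Anticommuting

/-! ### Homogeneous series -/

variable (p : Fin 2 → ZMod 2)

/-- The series all of whose coefficients are homogeneous of parity `a`. -/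
def HomogeneousSeries (a : ZMod 2) (φ : (Yangian p)⟦X⟧) : Prop := ∀ n, coeff n φ ∈ part p a

variable {p}

theorem HomogeneousSeries.mul {a b c : ZMod 2} {φ ψ : (Yangian p)⟦X⟧}
    (hφ : HomogeneousSeries p a φ) (hψ : HomogeneousSeries p b ψ) (h : a + b = c) :
    HomogeneousSeries p c (φ * ψ) := by
  intro n
  rw [coeff_mul]
  exact Submodule.sum_mem _ fun _ _ => mul_mem_part p (hφ _) (hψ _) h

theorem HomogeneousSeries.sub {a : ZMod 2} {φ ψ : (Yangian p)⟦X⟧}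
    (hφ : HomogeneousSeries p a φ) (hψ : HomogeneousSeries p a ψ) :
    HomogeneousSeries p a (φ - ψ) := by
  intro n
  rw [map_sub]
  exact sub_mem (hφ n) (hψ n)

/-- Each coefficient of the inverse is a sum of products of coefficients of `φ` with earlier
coefficients of the inverse, and even elements are closed under products. -/
theorem HomogeneousSeries.seriesInv {φ : (Yangian p)⟦X⟧} (hφ : HomogeneousSeries p 0 φ) :
    HomogeneousSeries p 0 (seriesInv φ) := by
  intro n
  induction n using Nat.strong_induction_on with
  | _ n ih =>
    rw [SuperYangian.seriesInv, coeff_invOfUnit]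
    split_ifs with h
    · rw [inv_one, Units.val_one]
      exact SetLike.GradedOne.one_mem
    · rw [inv_one, Units.val_one, neg_mul, one_mul]
      refine neg_mem (Submodule.sum_mem _ fun x _ => ?_)
      split_ifs with hx
      · exact mul_mem_part p (hφ _) (ih _ hx) (add_zero 0)
      · exact zero_mem _

variable (p)

theorem homogeneous_tSeries (i j : Fin 2) : HomogeneousSeries p (p i + p j) (tSeries p i j) := by
  intro n
  rw [tSeries, coeff_mk]
  exact t_mem p i j n

theorem homogeneous_d₁ : HomogeneousSeries p 0 (d₁ p) := by
  simpa only [d₁, CharTwo.add_self_eq_zero] using homogeneous_tSeries p 0 0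

theorem homogeneous_dt₁ : HomogeneousSeries p 0 (dt₁ p) := (homogeneous_d₁ p).seriesInv

theorem homogeneous_e : HomogeneousSeries p (p 0 + p 1) (e p) :=
  (homogeneous_dt₁ p).mul (homogeneous_tSeries p 0 1) (zero_add _)

theorem homogeneous_f : HomogeneousSeries p (p 0 + p 1) (f p) :=
  (homogeneous_tSeries p 1 0).mul (homogeneous_dt₁ p) (by rw [add_zero, add_comm])

theorem homogeneous_d₂ : HomogeneousSeries p 0 (d₂ p) := by
  refine HomogeneousSeries.sub ?_ ?_
  · simpa only [CharTwo.add_self_eq_zero] using homogeneous_tSeries p 1 1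
  · exact (homogeneous_f p).mul (homogeneous_tSeries p 0 1) (CharTwo.add_self_eq_zero _)

theorem homogeneous_dt₂ : HomogeneousSeries p 0 (dt₂ p) := (homogeneous_d₂ p).seriesInv

/-! ### The two embeddings of series and the comultiplication of series -/

/-- `a(u) ↦ a(u) ⊗ 1`. -/
def seriesLeft : (Yangian p)⟦X⟧ →+* (YY p)⟦X⟧ :=
  PowerSeries.map (GradedTensorProduct.includeLeft (part p) (part p)).toRingHom

/-- `b(u) ↦ 1 ⊗ b(u)`. -/
def seriesRight : (Yangian p)⟦X⟧ →+* (YY p)⟦X⟧ :=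
  PowerSeries.map (GradedTensorProduct.includeRight (part p) (part p)).toRingHom

theorem coeff_seriesLeft (a : (Yangian p)⟦X⟧) (n : ℕ) :
    coeff n (seriesLeft p a) = coeff n a ᵍ⊗ₜ[ℂ] 1 := rfl

theorem coeff_seriesRight (a : (Yangian p)⟦X⟧) (n : ℕ) :
    coeff n (seriesRight p a) = 1 ᵍ⊗ₜ[ℂ] coeff n a := rfl

/-- Turns `a(u) ⊗ b(u)` into an honest product in one ring, where the formulas become noncommutative
algebra. -/
theorem seriesLeft_mul_seriesRight (a b : (Yangian p)⟦X⟧) :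
    seriesLeft p a * seriesRight p b = tens a b := by
  ext n
  rw [coeff_mul, tens, coeff_mk]
  refine Finset.sum_congr rfl fun x _ => ?_
  rw [coeff_seriesLeft, coeff_seriesRight, GradedTensorProduct.tmul_one_mul_one_tmul]

theorem seriesRight_mul_seriesLeft {α β : ZMod 2} {a b : (Yangian p)⟦X⟧}
    (ha : HomogeneousSeries p α a) (hb : HomogeneousSeries p β b) :
    seriesRight p b * seriesLeft p a =
      sgn (β * α) • (seriesLeft p a * seriesRight p b) := by
  ext n
  -- The swap pairs the term `b^{(s)} a^{(r)}` with `a^{(r)} b^{(s)}`, so the sign rule applies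
  -- termwise.
  rw [coeff_smul, coeff_mul, coeff_mul, ← Finset.Nat.sum_antidiagonal_swap, Finset.smul_sum]
  refine Finset.sum_congr rfl fun x _ => ?_
  rw [coeff_seriesLeft, coeff_seriesRight, coeff_seriesLeft, coeff_seriesRight,
    GradedTensorProduct.tmul_one_mul_one_tmul]
  have h := GradedTensorProduct.tmul_coe_mul_coe_tmul (R := ℂ) (part p) (part p) 1
    ⟨coeff x.2 b, hb x.2⟩ ⟨coeff x.1 a, ha x.1⟩ 1
  rw [one_mul, mul_one, units_smul] at h
  exact h

theorem commute_seriesRight_seriesLeft_of_right {β : ZMod 2} {a b : (Yangian p)⟦X⟧}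
    (ha : HomogeneousSeries p 0 a) (hb : HomogeneousSeries p β b) :
    Commute (seriesRight p b) (seriesLeft p a) := by
  rw [Commute, SemiconjBy, seriesRight_mul_seriesLeft p ha hb, mul_zero, sgn_zero, one_smul]

theorem commute_seriesRight_seriesLeft_of_left {α : ZMod 2} {a b : (Yangian p)⟦X⟧}
    (ha : HomogeneousSeries p α a) (hb : HomogeneousSeries p 0 b) :
    Commute (seriesRight p b) (seriesLeft p a) := by
  rw [Commute, SemiconjBy, seriesRight_mul_seriesLeft p ha hb, zero_mul, sgn_zero, one_smul]

/-- The comultiplication of series as a ring homomorphism. -/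
def comulSeriesHom : (Yangian p)⟦X⟧ →+* (YY p)⟦X⟧ := PowerSeries.map (comul p).toRingHom

theorem comulSeriesHom_apply (a : (Yangian p)⟦X⟧) : comulSeriesHom p a = comulSeries a := by
  ext n
  rw [comulSeries, coeff_mk]
  rfl

/-- The matrix identity `Δ(T) = (T ⊗ 1)(1 ⊗ T)`, entry by entry. -/
theorem comulSeries_tSeries (i j : Fin 2) :
    comulSeries (tSeries p i j) =
      seriesLeft p (tSeries p i 0) * seriesRight p (tSeries p 0 j) +
        seriesLeft p (tSeries p i 1) * seriesRight p (tSeries p 1 j) := by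
  ext n
  rw [comulSeries, coeff_mk, tSeries, coeff_mk, comul_t, Fin.sum_univ_two]
  simp only [seriesLeft_mul_seriesRight, map_add, tens, coeff_mk, tSeries]

theorem d₁_mul_e : d₁ p * e p = tSeries p 0 1 := by
  rw [e, ← mul_assoc]
  exact (congrArg (· * _) (d₁_mul_dt₁ p)).trans (one_mul _)

theorem f_mul_d₁ : f p * d₁ p = tSeries p 1 0 := by
  rw [f, mul_assoc]
  exact (congrArg (_ * ·) (dt₁_mul_d₁ p)).trans (mul_one _)

theorem d₂_add_f_mul_d₁_mul_e : d₂ p + f p * d₁ p * e p = tSeries p 1 1 := by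
  rw [f_mul_d₁, e, d₂, ← mul_assoc, sub_add_cancel]

/-! ### Gauss factorization of a product in terms of the factors -/

/-- The Gauss factors of the product of the matrices with Gauss factors `F, (D₁, D₂), E` and
`F', (D₁', D₂'), E'`, where `v` is the inverse of `1 + E F'`. -/
theorem gauss_factors_mul {R : Type*} [Ring R]
    {D₁ N₁ D₂ E F D₁' N₁' D₂' E' F' v i T₁₁ T₁₂ T₂₁ T₂₂ : R}
    (hN : N₁ * D₁ = 1) (hN2 : D₁ * N₁ = 1) (hN' : N₁' * D₁' = 1) (hN2' : D₁' * N₁' = 1)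
    (hv : v * (1 + E * F') = 1) (hv2 : (1 + E * F') * v = 1) (hi : i * T₁₁ = 1)
    (h₁₁ : T₁₁ = D₁ * D₁' + D₁ * E * (F' * D₁'))
    (h₁₂ : T₁₂ = D₁ * (D₁' * E') + D₁ * E * (D₂' + F' * D₁' * E'))
    (h₂₁ : T₂₁ = F * D₁ * D₁' + (D₂ + F * D₁ * E) * (F' * D₁'))
    (h₂₂ : T₂₂ = F * D₁ * (D₁' * E') + (D₂ + F * D₁ * E) * (D₂' + F' * D₁' * E')) :
    i = N₁' * v * N₁ ∧
    i * T₁₂ = E' + N₁' * v * (E * D₂') ∧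
    T₂₁ * i = F + D₂ * F' * v * N₁ ∧
    T₂₂ - T₂₁ * i * T₁₂ = D₂ * (1 - F' * v * E) * D₂' := by
  subst h₁₁ h₁₂ h₂₁ h₂₂
  -- Here `T₁₁ = D₁ (1 + E F') D₁'`, whose inverse can be read off; uniqueness of inverses then
  -- identifies `i`.
  have h1 : (D₁ * D₁' + D₁ * E * (F' * D₁')) * (N₁' * v * N₁) = 1 := by
    calc _ = D₁ * (1 + E * F') * (D₁' * N₁') * v * N₁ := by noncomm_ring
      _ = D₁ * ((1 + E * F') * v) * N₁ := by rw [hN2']; noncomm_ring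
      _ = 1 := by rw [hv2, mul_one, hN2]
  have h0 : i = N₁' * v * N₁ := left_inv_eq_right_inv hi h1
  -- Uses `T₁₂ = D₁ ((1 + E F') D₁' E' + E D₂')`.
  have he : i * (D₁ * (D₁' * E') + D₁ * E * (D₂' + F' * D₁' * E')) =
      E' + N₁' * v * (E * D₂') := by
    calc _ = N₁' * v * (N₁ * D₁) * ((1 + E * F') * D₁' * E' + E * D₂') := by
          rw [h0]; noncomm_ring
      _ = N₁' * (v * (1 + E * F')) * D₁' * E' + N₁' * v * (E * D₂') := by
          rw [hN]; noncomm_ring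
      _ = _ := by rw [hv, mul_one, hN', one_mul]
  -- Uses `T₂₁ = (F D₁ (1 + E F') + D₂ F') D₁'`.
  have hf : (F * D₁ * D₁' + (D₂ + F * D₁ * E) * (F' * D₁')) * i = F + D₂ * F' * v * N₁ := by
    calc _ = (F * D₁ * (1 + E * F') + D₂ * F') * (D₁' * N₁') * v * N₁ := by
          rw [h0]; noncomm_ring
      _ = F * D₁ * ((1 + E * F') * v) * N₁ + D₂ * F' * v * N₁ := by
          rw [hN2']; noncomm_ring
      _ = _ := by rw [hv2, mul_one, mul_assoc F, hN2, mul_one]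
  refine ⟨h0, he, hf, ?_⟩
  rw [hf]
  -- The summand `F T₁₂` of `T₂₁ i T₁₂` cancels every term of `T₂₂` that contains `F`.
  calc _ = D₂ * D₂' + D₂ * F' * D₁' * E' - D₂ * F' * v * (N₁ * D₁) *
        ((1 + E * F') * D₁' * E' + E * D₂') := by noncomm_ring
    _ = D₂ * D₂' + D₂ * F' * D₁' * E' - D₂ * F' * (v * (1 + E * F')) * D₁' * E' -
        D₂ * F' * v * E * D₂' := by rw [hN]; noncomm_ring
    _ = _ := by rw [hv]; noncomm_ring

end SuperYangian

end
-- Closed form of the comultiplication on the Gauss factors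
noncomputable section

namespace SuperYangian

open PowerSeries

variable (p : Fin 2 → ZMod 2)

/-- The parity of both series is `|1| + |2| = 1`. This is where `|1| ≠ |2|` enters. -/
theorem seriesRight_f_mul_seriesLeft_e (hp : p 0 ≠ p 1) :
    seriesRight p (f p) * seriesLeft p (e p) = -(seriesLeft p (e p) * seriesRight p (f p)) := by
  have h : ∀ a b : ZMod 2, a ≠ b → (a + b) * (a + b) = 1 := by decide
  rw [seriesRight_mul_seriesLeft p (homogeneous_e p) (homogeneous_f p), h _ _ hp, sgn_one,
    neg_one_smul]

/-- The constant term of `e(u)` vanishes because `t_{1,2}^{(0)} = 0`; this makes the geometric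
series in `e ⊗ f` converge. -/
theorem X_dvd_seriesLeft_e_mul (φ : (YY p)⟦X⟧) : X ∣ seriesLeft p (e p) * φ := by
  rw [X_dvd_iff, map_mul]
  have h : constantCoeff (seriesLeft p (e p)) = 0 := by
    rw [seriesLeft, ← coeff_zero_eq_constantCoeff_apply, coeff_map,
      coeff_zero_eq_constantCoeff_apply, e, map_mul, constantCoeff_tSeries]
    simp
  rw [h, zero_mul]

theorem exists_inverse_one_add (z : (YY p)⟦X⟧) (hz : X ∣ z) :
    ∃ v, v * (1 + z) = 1 ∧ (1 + z) * v = 1 := by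
  have h : constantCoeff (1 + z) = ((1 : (YY p)ˣ) : YY p) := by
    rw [map_add, X_dvd_iff.1 hz, map_one, add_zero, Units.val_one]
  exact ⟨_, invOfUnit_mul _ _ h, mul_invOfUnit _ _ h⟩

theorem map_mul_eq_one {R S : Type*} [Ring R] [Ring S] (F : R →+* S) {a b : R} (h : a * b = 1) :
    F a * F b = 1 := by
  rw [← map_mul, h, map_one]

/-- This and the next three lemmas put the entries of `Δ(T)` into the shape of the hypotheses of
`gauss_factors_mul`. -/
theorem comulSeries_tSeries_zero_zero :
    comulSeries (tSeries p 0 0) = seriesLeft p (d₁ p) * seriesRight p (d₁ p) +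
      seriesLeft p (d₁ p) * seriesLeft p (e p) *
        (seriesRight p (f p) * seriesRight p (d₁ p)) := by
  rw [comulSeries_tSeries, ← d₁_mul_e, ← f_mul_d₁, map_mul, map_mul]
  rfl

theorem comulSeries_tSeries_zero_one :
    comulSeries (tSeries p 0 1) =
      seriesLeft p (d₁ p) * (seriesRight p (d₁ p) * seriesRight p (e p)) +
      seriesLeft p (d₁ p) * seriesLeft p (e p) *
        (seriesRight p (d₂ p) + seriesRight p (f p) * seriesRight p (d₁ p) *
          seriesRight p (e p)) := by
  rw [comulSeries_tSeries, ← d₁_mul_e, ← d₂_add_f_mul_d₁_mul_e]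
  simp only [map_mul, map_add]
  rfl

theorem comulSeries_tSeries_one_zero :
    comulSeries (tSeries p 1 0) =
      seriesLeft p (f p) * seriesLeft p (d₁ p) * seriesRight p (d₁ p) +
      (seriesLeft p (d₂ p) + seriesLeft p (f p) * seriesLeft p (d₁ p) * seriesLeft p (e p)) *
        (seriesRight p (f p) * seriesRight p (d₁ p)) := by
  rw [comulSeries_tSeries, ← f_mul_d₁, ← d₂_add_f_mul_d₁_mul_e]
  simp only [map_mul, map_add]
  rfl

theorem comulSeries_tSeries_one_one :
    comulSeries (tSeries p 1 1) =
      seriesLeft p (f p) * seriesLeft p (d₁ p) * (seriesRight p (d₁ p) * seriesRight p (e p)) +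
      (seriesLeft p (d₂ p) + seriesLeft p (f p) * seriesLeft p (d₁ p) * seriesLeft p (e p)) *
        (seriesRight p (d₂ p) + seriesRight p (f p) * seriesRight p (d₁ p) *
          seriesRight p (e p)) := by
  rw [comulSeries_tSeries, ← f_mul_d₁, ← d₁_mul_e, ← d₂_add_f_mul_d₁_mul_e]
  simp only [map_mul, map_add]

/-- The comultiplication of the Drinfeld series in closed form, with `v = (1 + e(u) ⊗ f(u))⁻¹`. -/
theorem exists_comulSeries_closed_form : ∃ v : (YY p)⟦X⟧,
    v * (1 + seriesLeft p (e p) * seriesRight p (f p)) = 1 ∧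
    (1 + seriesLeft p (e p) * seriesRight p (f p)) * v = 1 ∧
    comulSeries (dt₁ p) = seriesRight p (dt₁ p) * v * seriesLeft p (dt₁ p) ∧
    comulSeries (e p) = seriesRight p (e p) +
      seriesRight p (dt₁ p) * v * (seriesLeft p (e p) * seriesRight p (d₂ p)) ∧
    comulSeries (f p) = seriesLeft p (f p) +
      seriesLeft p (d₂ p) * seriesRight p (f p) * v * seriesLeft p (dt₁ p) ∧
    comulSeries (d₂ p) = seriesLeft p (d₂ p) *
      (1 - seriesRight p (f p) * v * seriesLeft p (e p)) * seriesRight p (d₂ p) := by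
  obtain ⟨v, hv, hv2⟩ := exists_inverse_one_add p _ (X_dvd_seriesLeft_e_mul p (seriesRight p (f p)))
  -- `Δ` is multiplicative on series, so `Δ(d̃₁)` is a left inverse of `Δ(t_{1,1})`.
  have hi := map_mul_eq_one (comulSeriesHom p) (dt₁_mul_d₁ p)
  rw [comulSeriesHom_apply, comulSeriesHom_apply, d₁] at hi
  obtain ⟨h1, h2, h3, h4⟩ := gauss_factors_mul (D₂ := seriesLeft p (d₂ p))
    (F := seriesLeft p (f p)) (D₂' := seriesRight p (d₂ p)) (E' := seriesRight p (e p))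
    (map_mul_eq_one (seriesLeft p) (dt₁_mul_d₁ p)) (map_mul_eq_one (seriesLeft p) (d₁_mul_dt₁ p))
    (map_mul_eq_one (seriesRight p) (dt₁_mul_d₁ p)) (map_mul_eq_one (seriesRight p) (d₁_mul_dt₁ p))
    hv hv2 hi (comulSeries_tSeries_zero_zero p) (comulSeries_tSeries_zero_one p)
    (comulSeries_tSeries_one_zero p) (comulSeries_tSeries_one_one p)
  refine ⟨v, hv, hv2, h1, ?_, ?_, ?_⟩
  · rw [← h2, e, ← comulSeriesHom_apply, map_mul, comulSeriesHom_apply, comulSeriesHom_apply]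
    rfl
  · rw [← h3, f, ← comulSeriesHom_apply, map_mul, comulSeriesHom_apply, comulSeriesHom_apply]
    rfl
  · rw [← h4, d₂, ← comulSeriesHom_apply]
    simp only [map_sub, map_mul, comulSeriesHom_apply]
    rfl

/-! ### The six formulas -/

theorem comulSeries_d₁ :
    comulSeries (d₁ p) = tens (d₁ p) (d₁ p) + tens (d₁ p * e p) (f p * d₁ p) := by
  rw [d₁, comulSeries_tSeries_zero_zero]
  simp only [← seriesLeft_mul_seriesRight, map_mul]
  rfl

variable {p}

theorem comulSeries_dt₁ (hp : p 0 ≠ p 1) :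
    FormallySummable (fun n : ℕ =>
        (-1 : ℂ) ^ (n ⌈/⌉ 2) • tens (e p ^ n * dt₁ p) (dt₁ p * f p ^ n)) ∧
      comulSeries (dt₁ p) = formalSum (fun n : ℕ =>
        (-1 : ℂ) ^ (n ⌈/⌉ 2) • tens (e p ^ n * dt₁ p) (dt₁ p * f p ^ n)) := by
  obtain ⟨v, hv, -, h, -⟩ := exists_comulSeries_closed_form p
  rw [h]
  refine geometric_formalSum _ _ (w := -(seriesLeft p (e p) * seriesRight p (f p)))
    ((dvd_neg).2 (X_dvd_seriesLeft_e_mul p _)) (by rwa [sub_neg_eq_add]) fun n => ?_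
  -- The even series `1 ⊗ d̃₁` and `d̃₁ ⊗ 1` move into place on their own side of the tensor sign at
  -- no cost.
  have c1 := (commute_seriesRight_seriesLeft_of_left p (homogeneous_e p)
    (homogeneous_dt₁ p)).pow_right n
  have c2 := (commute_seriesRight_seriesLeft_of_right p (homogeneous_dt₁ p)
    (homogeneous_f p)).pow_left n
  have c3 := commute_seriesRight_seriesLeft_of_left p (homogeneous_dt₁ p) (homogeneous_dt₁ p)
  rw [neg_mul_pow_of_anticommute (seriesRight_f_mul_seriesLeft_e p hp), mul_smul_comm,
    smul_mul_assoc, ← seriesLeft_mul_seriesRight, map_mul, map_mul, map_pow, map_pow]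
  congr 1
  rw [← mul_assoc, c1.eq, mul_assoc, c2.eq, ← mul_assoc, mul_assoc (_ ^ n), c3.eq]
  simp only [mul_assoc]

theorem comulSeries_e (hp : p 0 ≠ p 1) :
    FormallySummable (fun n : ℕ+ =>
        (-1 : ℂ) ^ ((n : ℕ) ⌈/⌉ 2) •
          tens (e p ^ (n : ℕ)) (dt₁ p * f p ^ ((n : ℕ) - 1) * d₂ p)) ∧
      comulSeries (e p) = tens 1 (e p) - formalSum (fun n : ℕ+ =>
        (-1 : ℂ) ^ ((n : ℕ) ⌈/⌉ 2) •
          tens (e p ^ (n : ℕ)) (dt₁ p * f p ^ ((n : ℕ) - 1) * d₂ p)) := by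
  obtain ⟨v, hv, -, -, h, -⟩ := exists_comulSeries_closed_form p
  -- The prefactor is negated because the formula subtracts the sum. The trailing `e ⊗ 1` joins the
  -- `n`-th power and raises the index to `n + 1`.
  obtain ⟨h1, h2⟩ := geometric_formalSum (-seriesRight p (dt₁ p))
    (seriesLeft p (e p) * seriesRight p (d₂ p))
    (w := -(seriesLeft p (e p) * seriesRight p (f p))) (v := v)
    (g := fun n : ℕ => (-1 : ℂ) ^ ((n.succPNat : ℕ) ⌈/⌉ 2) •
          tens (e p ^ (n.succPNat : ℕ)) (dt₁ p * f p ^ ((n.succPNat : ℕ) - 1) * d₂ p))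
    ((dvd_neg).2 (X_dvd_seriesLeft_e_mul p _)) (by rwa [sub_neg_eq_add]) (by
      intro n
      have c1 := (commute_seriesRight_seriesLeft_of_left p (homogeneous_e p)
        (homogeneous_dt₁ p)).pow_right (n + 1)
      rw [← mul_assoc, mul_assoc (-seriesRight p (dt₁ p)),
        neg_mul_pow_mul_of_anticommute (seriesRight_f_mul_seriesLeft_e p hp), neg_mul_comm,
        neg_smul, neg_neg, mul_smul_comm, smul_mul_assoc, ← seriesLeft_mul_seriesRight,
        Nat.succPNat_coe, Nat.succ_eq_add_one, add_tsub_cancel_right]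
      simp only [map_mul, map_pow]
      congr 1
      rw [← mul_assoc, c1.eq]
      simp only [mul_assoc])
  obtain ⟨h3, h4⟩ := formalSum_pnat (g := fun n : ℕ+ =>
    (-1 : ℂ) ^ ((n : ℕ) ⌈/⌉ 2) • tens (e p ^ (n : ℕ)) (dt₁ p * f p ^ ((n : ℕ) - 1) * d₂ p)) h1
  refine ⟨h3, ?_⟩
  rw [← h4, ← h2, h, ← seriesLeft_mul_seriesRight, map_one, one_mul]
  noncomm_ring

theorem comulSeries_f (hp : p 0 ≠ p 1) :
    FormallySummable (fun n : ℕ+ =>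
        (-1 : ℂ) ^ ((n : ℕ) ⌈/⌉ 2) •
          tens (d₂ p * e p ^ ((n : ℕ) - 1) * dt₁ p) (f p ^ (n : ℕ))) ∧
      comulSeries (f p) = tens (f p) 1 - formalSum (fun n : ℕ+ =>
        (-1 : ℂ) ^ ((n : ℕ) ⌈/⌉ 2) •
          tens (d₂ p * e p ^ ((n : ℕ) - 1) * dt₁ p) (f p ^ (n : ℕ))) := by
  obtain ⟨v, hv, -, -, -, h, -⟩ := exists_comulSeries_closed_form p
  -- Negated as for `Δ(e)`; here the leading `1 ⊗ f` raises the index.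
  obtain ⟨h1, h2⟩ := geometric_formalSum (-(seriesLeft p (d₂ p) * seriesRight p (f p)))
    (seriesLeft p (dt₁ p))
    (w := -(seriesLeft p (e p) * seriesRight p (f p))) (v := v)
    (g := fun n : ℕ => (-1 : ℂ) ^ ((n.succPNat : ℕ) ⌈/⌉ 2) •
          tens (d₂ p * e p ^ ((n.succPNat : ℕ) - 1) * dt₁ p) (f p ^ (n.succPNat : ℕ)))
    ((dvd_neg).2 (X_dvd_seriesLeft_e_mul p _)) (by rwa [sub_neg_eq_add]) (by
      intro n
      have c1 := (commute_seriesRight_seriesLeft_of_right p (homogeneous_dt₁ p)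
        (homogeneous_f p)).pow_left (n + 1)
      rw [neg_mul, mul_assoc (seriesLeft p (d₂ p)),
        mul_neg_mul_pow_of_anticommute (seriesRight_f_mul_seriesLeft_e p hp), ← mul_neg,
        neg_smul, neg_neg, mul_smul_comm, smul_mul_assoc, ← seriesLeft_mul_seriesRight,
        Nat.succPNat_coe, Nat.succ_eq_add_one, add_tsub_cancel_right]
      simp only [map_mul, map_pow]
      congr 1
      rw [← mul_assoc, mul_assoc, c1.eq]
      simp only [mul_assoc])
  obtain ⟨h3, h4⟩ := formalSum_pnat (g := fun n : ℕ+ =>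
    (-1 : ℂ) ^ ((n : ℕ) ⌈/⌉ 2) •
      tens (d₂ p * e p ^ ((n : ℕ) - 1) * dt₁ p) (f p ^ (n : ℕ))) h1
  refine ⟨h3, ?_⟩
  rw [← h4, ← h2, h, ← seriesLeft_mul_seriesRight, map_one, mul_one]
  noncomm_ring

/-- This is `(1 + yx)⁻¹ = 1 - y (1 + xy)⁻¹ x`, with `yx` replaced by `-xy`. -/
theorem one_sub_mul_mul_one_sub {R : Type*} [Ring R] {x y v : R} (h : y * x = -(x * y))
    (hv : v * (1 + x * y) = 1) : (1 - y * v * x) * (1 - x * y) = 1 := by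
  rw [sub_eq_add_neg 1 (x * y), ← h]
  calc _ = 1 + y * x - y * (v * (1 + x * y)) * x := by noncomm_ring
    _ = 1 := by rw [hv, mul_one, add_sub_cancel_right]

theorem comulSeries_d₂ (hp : p 0 ≠ p 1) :
    FormallySummable (fun n : ℕ =>
        (-1 : ℂ) ^ (n / 2) • tens (d₂ p * e p ^ n) (f p ^ n * d₂ p)) ∧
      comulSeries (d₂ p) = formalSum (fun n : ℕ =>
        (-1 : ℂ) ^ (n / 2) • tens (d₂ p * e p ^ n) (f p ^ n * d₂ p)) := by
  obtain ⟨v, hv, -, -, -, -, h⟩ := exists_comulSeries_closed_form p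
  rw [h]
  -- The ratio is now `+xy`, whence the floor instead of the ceiling in the sign.
  refine geometric_formalSum _ _ (X_dvd_seriesLeft_e_mul p _)
    (one_sub_mul_mul_one_sub (seriesRight_f_mul_seriesLeft_e p hp) hv) fun n => ?_
  rw [mul_pow_of_anticommute (seriesRight_f_mul_seriesLeft_e p hp), mul_smul_comm,
    smul_mul_assoc, ← seriesLeft_mul_seriesRight, map_mul, map_mul, map_pow, map_pow]
  simp only [mul_assoc]

theorem comulSeries_dt₂ (hp : p 0 ≠ p 1) :
    comulSeries (dt₂ p) = tens (dt₂ p) (dt₂ p) - tens (e p * dt₂ p) (dt₂ p * f p) := by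
  obtain ⟨v, hv, -, -, -, -, h⟩ := exists_comulSeries_closed_form p
  have hi := map_mul_eq_one (comulSeriesHom p) (dt₂_mul_d₂ p)
  rw [comulSeriesHom_apply, comulSeriesHom_apply, h] at hi
  have hw := one_sub_mul_mul_one_sub (seriesRight_f_mul_seriesLeft_e p hp) hv
  -- As `Δ(d₂) = d₂ (1 - xy)⁻¹ d₂'`, the candidate inverse is `d̃₂' (1 - xy) d̃₂`.
  have h2 : seriesLeft p (d₂ p) * (1 - seriesRight p (f p) * v * seriesLeft p (e p)) *
      seriesRight p (d₂ p) * (seriesRight p (dt₂ p) *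
        (1 - seriesLeft p (e p) * seriesRight p (f p)) * seriesLeft p (dt₂ p)) = 1 := by
    simp only [mul_assoc] at hw ⊢
    rw [← mul_assoc (seriesRight p (d₂ p)), map_mul_eq_one (seriesRight p) (d₂_mul_dt₂ p), one_mul,
      ← mul_assoc (1 - _) (1 - _), hw, one_mul, map_mul_eq_one (seriesLeft p) (d₂_mul_dt₂ p)]
  have c1 := commute_seriesRight_seriesLeft_of_left p (homogeneous_e p) (homogeneous_dt₂ p)
  have c2 := commute_seriesRight_seriesLeft_of_right p (homogeneous_dt₂ p) (homogeneous_f p)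
  have c3 := commute_seriesRight_seriesLeft_of_left p (homogeneous_dt₂ p) (homogeneous_dt₂ p)
  rw [left_inv_eq_right_inv hi h2, ← seriesLeft_mul_seriesRight, ← seriesLeft_mul_seriesRight,
    map_mul, map_mul, mul_sub, sub_mul, mul_one, c3.eq, ← mul_assoc, c1.eq]
  congr 1
  rw [mul_assoc, c2.eq, ← mul_assoc, mul_assoc _ (seriesRight p (dt₂ p)), c3.eq]
  simp only [mul_assoc]

end SuperYangian

end

theorem mainTheorem10 (p : Fin 2 → ZMod 2) (hp : p 0 ≠ p 1) :
    -- the formula for `Δ(d_1(u))`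
    comulSeries (d₁ p) = tens (d₁ p) (d₁ p) + tens (d₁ p * e p) (f p * d₁ p) ∧
    -- the formula for `Δ(d̃_1(u))`
    (FormallySummable (fun n : ℕ =>
        (-1 : ℂ) ^ (n ⌈/⌉ 2) • tens (e p ^ n * dt₁ p) (dt₁ p * f p ^ n)) ∧
      comulSeries (dt₁ p) = formalSum (fun n : ℕ =>
        (-1 : ℂ) ^ (n ⌈/⌉ 2) • tens (e p ^ n * dt₁ p) (dt₁ p * f p ^ n))) ∧
    -- the formula for `Δ(d_2(u))`
    (FormallySummable (fun n : ℕ =>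
        (-1 : ℂ) ^ (n / 2) • tens (d₂ p * e p ^ n) (f p ^ n * d₂ p)) ∧
      comulSeries (d₂ p) = formalSum (fun n : ℕ =>
        (-1 : ℂ) ^ (n / 2) • tens (d₂ p * e p ^ n) (f p ^ n * d₂ p))) ∧
    -- the formula for `Δ(d̃_2(u))`
    comulSeries (dt₂ p) = tens (dt₂ p) (dt₂ p) - tens (e p * dt₂ p) (dt₂ p * f p) ∧
    -- the formula for `Δ(e(u))`
    (FormallySummable (fun n : ℕ+ =>
        (-1 : ℂ) ^ ((n : ℕ) ⌈/⌉ 2) •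
          tens (e p ^ (n : ℕ)) (dt₁ p * f p ^ ((n : ℕ) - 1) * d₂ p)) ∧
      comulSeries (e p) = tens 1 (e p) - formalSum (fun n : ℕ+ =>
        (-1 : ℂ) ^ ((n : ℕ) ⌈/⌉ 2) •
          tens (e p ^ (n : ℕ)) (dt₁ p * f p ^ ((n : ℕ) - 1) * d₂ p))) ∧
    -- the formula for `Δ(f(u))`
    (FormallySummable (fun n : ℕ+ =>
        (-1 : ℂ) ^ ((n : ℕ) ⌈/⌉ 2) •
          tens (d₂ p * e p ^ ((n : ℕ) - 1) * dt₁ p) (f p ^ (n : ℕ))) ∧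
      comulSeries (f p) = tens (f p) 1 - formalSum (fun n : ℕ+ =>
        (-1 : ℂ) ^ ((n : ℕ) ⌈/⌉ 2) •
          tens (d₂ p * e p ^ ((n : ℕ) - 1) * dt₁ p) (f p ^ (n : ℕ)))) := by
  exact ⟨comulSeries_d₁ p, comulSeries_dt₁ hp, comulSeries_d₂ hp, comulSeries_dt₂ hp,
    comulSeries_e hp, comulSeries_f hp⟩
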